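/- Theorem (uniform-over-$p$ CLT). Let $d \ge 1$ be fixed and let $(k_n)_{n\in\mathbb N}$ be natural numbers with $k_n \to \infty$ as $n\to\infty$. For all $n,p\in\mathbb N$ let $\mathbf X_{n,p,1},\dots,\mathbf X_{n,p,k_n}$ be independent $d$-dimensional random vectors with mean zero and $\mathrm E[\|\mathbf X_{n,p,r}\|^2]<\infty$ for $1\le r\le k_n$, and put $\mathbf S_{n,p}=\mathbf X_{n,p,1}+\dots+\mathbf X_{n,p,k_n}$. Let $\mathbf e_1,\dots,\mathbf e_d$ be the canonical basis of $\mathbb R^d$, and suppose that for each $p\in\mathbb N$ there is a real $d\times d$ matrix $\boldsymbol\Sigma_p=(\sigma_{p,ij})$ such that: (a) $\lim_{n\to\infty}\sup_{p\in\mathbb N}\left|\mathbf e_i^\top \mathrm{Cov}(\mathbf S_{n,p})\mathbf e_j-\sigma_{p,ij}\right|=0$ for all $1\le i,j\le d$; (b) $\sup_{p\in\mathbb N}\sigma_{p,ii}<\infty$ for all $1\le i\le d$; (c) for every $\epsilon>0$ and $1\le i\le d$, $$\lim_{n\to\infty}\sup_{p\in\mathbb N}\sum_{r=1}^{k_n}\mathrm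 E\left[(\mathbf e_i^\top\mathbf X_{n,p,r})^2\,\mathbb I\{|\mathbf e_i^\top\mathbf X_{n,p,r}|>\epsilon\}\right]=0.$$ Then each $\boldsymbol\Sigma_p$ is symmetric and positive semidefinite, and $\mathbf S_{n,p}\Longrightarrow N_d(\mathbf 0_d,\boldsymbol\Sigma_p)$ uniformly over $p$ as $n\to\infty$; that is, for every bounded continuous $f:\mathbb R^d\to\mathbb R$, $$\lim_{n\to\infty}\sup_{p\in\mathbb N}\left|\mathrm E[f(\mathbf S_{n,p})]-\int f\,\mathrm dN_d(\mathbf 0_d,\boldsymbol\Sigma_p)\right|=0.$$ -/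

import Mathlib

open MeasureTheory ProbabilityTheory Filter Topology
open scoped BoundedContinuousFunction ENNReal

/-- `a n p → b p` as `n → ∞`, uniformly over `p ∈ ℕ`: the supremum over `p` of `|a n p - b p|`,
taken in `[0, ∞]` (so that it is `∞` when the differences are unbounded), tends to `0`. -/
def TendstoUniformOver (a : ℕ → ℕ → ℝ) (b : ℕ → ℝ) : Prop :=
  Tendsto (fun n ↦ ⨆ p : ℕ, ENNReal.ofReal |a n p - b p|) atTop (𝓝 0)

/-- Uniform-over-`p` weak convergence `μ n p ⟹ ν p` as `n → ∞`: for every bounded continuous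
real function `f`, `sup_p |∫ f dμ_{n,p} - ∫ f dν_p| → 0`. -/
def WeakConvUniformOver {E : Type*} [TopologicalSpace E] [MeasurableSpace E]
    (μ : ℕ → ℕ → Measure E) (ν : ℕ → Measure E) : Prop :=
  ∀ f : E →ᵇ ℝ, TendstoUniformOver (fun n p ↦ ∫ x, f x ∂(μ n p)) (fun p ↦ ∫ x, f x ∂(ν p))

open scoped RealInnerProductSpace Matrix

/-! ### Uniform convergence as convergence along sequences -/

section UniformOver

/-! Convergence uniform over `p` amounts to convergence along every choice `n ↦ q n`, which turns
the claim into one about ordinary triangular arrays. Condition (b) and positive semidefiniteness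
confine all the matrices `Sig p` to a compact box, so every subsequence has a further one along
which `Sig (q n)` converges to some `N`. Along it the sums have covariances tending to `N` and
satisfy Lindeberg's condition, so they converge weakly to the Gaussian with covariance `N`
(`tendsto_integral_map_sum_of_lindeberg`). The Gaussians with covariance `Sig (q n)` have that same
limit (`tendsto_integral_multivariateGaussian`), and the difference of integrals tends to zero.

Both limits come from Lévy's continuity theorem. For the sums, each factor of the characteristic
function is compared with the Gaussian factor of equal variance (`norm_charFun_map_sum_sub_exp_le`).
-/

lemma TendstoUniformOver.tendsto_sub {a : ℕ → ℕ → ℝ} {b : ℕ → ℝ} (h : TendstoUniformOver a b)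
    {u : ℕ → ℕ} (hu : Tendsto u atTop atTop) (q : ℕ → ℕ) :
    Tendsto (fun n ↦ a (u n) (q n) - b (q n)) atTop (𝓝 0) := by
  have h1 : Tendsto (fun n ↦ ENNReal.ofReal |a (u n) (q n) - b (q n)|) atTop (𝓝 0) :=
    tendsto_of_tendsto_of_tendsto_of_le_of_le tendsto_const_nhds (h.comp hu) (fun _ ↦ zero_le)
      (fun n ↦ le_iSup (fun p ↦ ENNReal.ofReal |a (u n) p - b p|) (q n))
  have h2 := (ENNReal.tendsto_toReal ENNReal.zero_ne_top).comp h1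
  refine (tendsto_zero_iff_abs_tendsto_zero _).2 ?_
  simpa [Function.comp_def] using h2

lemma tendstoUniformOver_of_forall_seq {a : ℕ → ℕ → ℝ} {b : ℕ → ℝ}
    (h : ∀ q : ℕ → ℕ, Tendsto (fun n ↦ a n (q n) - b (q n)) atTop (𝓝 0)) :
    TendstoUniformOver a b := by
  rw [TendstoUniformOver, ENNReal.tendsto_nhds_zero]
  intro ε hε
  -- `q n` is an index violating the bound `ε` whenever one exists; the value `0` otherwise is a
  -- dummy.
  have hex : ∀ n, ∃ p, (∃ p', ε < ENNReal.ofReal |a n p' - b p'|) →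
      ε < ENNReal.ofReal |a n p - b p| := fun n ↦ by
    by_cases hn : ∃ p', ε < ENNReal.ofReal |a n p' - b p'|
    · exact hn.imp fun p hp _ ↦ hp
    · exact ⟨0, fun hn' ↦ absurd hn' hn⟩
  choose q hq using hex
  have h1 : Tendsto (fun n ↦ ENNReal.ofReal |a n (q n) - b (q n)|) atTop (𝓝 0) := by
    simpa using ENNReal.tendsto_ofReal (h q).abs
  filter_upwards [ENNReal.tendsto_nhds_zero.1 h1 ε hε] with n hn
  refine iSup_le fun p ↦ not_lt.1 fun hp ↦ ?_
  exact absurd (hq n ⟨p, hp⟩) (not_lt.2 hn)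

end UniformOver

/-! ### Elementary estimates for products and exponentials -/

section Bounds

/-- Factors are exchanged one at a time; those left over have norm at most one. -/
lemma norm_prod_sub_prod_le_sum {ι R : Type*} [NormedCommRing R] [NormOneClass R] (s : Finset ι)
    {f g : ι → R}
    (hf : ∀ i ∈ s, ‖f i‖ ≤ 1) (hg : ∀ i ∈ s, ‖g i‖ ≤ 1) :
    ‖∏ i ∈ s, f i - ∏ i ∈ s, g i‖ ≤ ∑ i ∈ s, ‖f i - g i‖ := by
  classical
  induction s using Finset.induction with
  | empty => simp
  | insert a s ha ih =>
    have ih' := ih (fun i hi ↦ hf i (Finset.mem_insert_of_mem hi))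
      (fun i hi ↦ hg i (Finset.mem_insert_of_mem hi))
    have hG : ‖∏ i ∈ s, g i‖ ≤ 1 := (Finset.norm_prod_le s g).trans <|
      Finset.prod_le_one (fun i _ ↦ norm_nonneg _)
        (fun i hi ↦ hg i (Finset.mem_insert_of_mem hi))
    rw [Finset.prod_insert ha, Finset.prod_insert ha, Finset.sum_insert ha]
    calc ‖f a * ∏ i ∈ s, f i - g a * ∏ i ∈ s, g i‖
        = ‖(f a - g a) * ∏ i ∈ s, g i + f a * (∏ i ∈ s, f i - ∏ i ∈ s, g i)‖ := by ring_nf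
      _ ≤ ‖f a - g a‖ * ‖∏ i ∈ s, g i‖ + ‖f a‖ * ‖∏ i ∈ s, f i - ∏ i ∈ s, g i‖ :=
        (norm_add_le _ _).trans (add_le_add (norm_mul_le _ _) (norm_mul_le _ _))
      _ ≤ ‖f a - g a‖ * 1 + 1 * ‖∏ i ∈ s, f i - ∏ i ∈ s, g i‖ := by
        gcongr
        exact hf a (Finset.mem_insert_self _ _)
      _ ≤ _ := by linarith

/-- For `|x| ≤ ε` the cubic Taylor remainder is at most `ε * x ^ 2`. Beyond `ε` a quadratic bound
suffices: for `|x| > 1` the crude estimate `2 + |x| + x ^ 2 / 2` is below `4 * x ^ 2`. -/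
lemma norm_exp_mul_I_sub_taylor_two_le {ε : ℝ} (hε0 : 0 < ε) (hε1 : ε ≤ 1) (x : ℝ) :
    ‖Complex.exp (x * Complex.I) - (1 + x * Complex.I - x ^ 2 / 2)‖ ≤
      ε * x ^ 2 + 4 * {y : ℝ | ε < |y|}.indicator (fun y ↦ y ^ 2) x := by
  have hsmall : |x| ≤ 1 →
      ‖Complex.exp (x * Complex.I) - (1 + x * Complex.I - x ^ 2 / 2)‖ ≤ |x| * x ^ 2 := by
    intro hx
    have h := Complex.exp_bound (x := x * Complex.I) (by simpa using hx) (n := 3) (by norm_num)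
    have he : ∑ m ∈ Finset.range 3, (x * Complex.I) ^ m / (m.factorial : ℂ) =
        1 + x * Complex.I - x ^ 2 / 2 := by
      simp [Finset.sum_range_succ, Nat.factorial, mul_pow]
      ring
    rw [he] at h
    refine h.trans ?_
    have h3 : |x| * x ^ 2 = |x| ^ 3 := by rw [← sq_abs x]; ring
    rw [h3]
    simp only [norm_mul, Complex.norm_real, Complex.norm_I, mul_one, Real.norm_eq_abs]
    have : 0 ≤ |x| ^ 3 := by positivity
    norm_num [Nat.factorial]
    linarith
  by_cases hx : ε < |x|
  · rw [Set.indicator_of_mem (by exact hx)]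
    have hx2 : 0 ≤ x ^ 2 := sq_nonneg x
    by_cases hx1 : |x| ≤ 1
    · nlinarith [hsmall hx1]
    · push Not at hx1
      have : ‖Complex.exp (x * Complex.I) - (1 + x * Complex.I - x ^ 2 / 2)‖ ≤
          1 + (1 + |x| + x ^ 2 / 2) := by
        refine (norm_sub_le _ _).trans (add_le_add (Complex.norm_exp_ofReal_mul_I x).le ?_)
        refine (norm_sub_le _ _).trans (add_le_add ((norm_add_le _ _).trans ?_) ?_)
        · simp
        · simp
      nlinarith [sq_abs x, abs_nonneg x]
  · rw [Set.indicator_of_notMem (by exact hx)]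
    push Not at hx
    have := hsmall (hx.trans hε1)
    nlinarith [sq_nonneg x]

lemma abs_exp_neg_sub_one_sub_le {a : ℝ} (ha : 0 ≤ a) : |Real.exp (-a) - (1 - a)| ≤ a ^ 2 := by
  by_cases h : a ≤ 1
  · have := Real.abs_exp_sub_one_sub_id_le (x := -a) (by rwa [abs_neg, abs_of_nonneg ha])
    rw [neg_sq] at this
    convert this using 2
    ring
  · push Not at h
    have h1 := Real.add_one_le_exp (-a)
    have h2 : Real.exp (-a) ≤ 1 := Real.exp_le_one_iff.2 (by linarith)
    rw [abs_of_nonneg (by linarith)]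
    nlinarith

end Bounds

/-! ### Quantitative Lindeberg bound -/

section Lindeberg

variable {Ω : Type*} [MeasurableSpace Ω] {P : Measure Ω}

lemma integrable_indicator_sq {Y : Ω → ℝ} (hYm : Measurable Y) (hY : MemLp Y 2 P) (ε : ℝ) :
    Integrable (fun ω ↦ {ω' | ε < |Y ω'|}.indicator (fun ω' ↦ Y ω' ^ 2) ω) P :=
  hY.integrable_sq.indicator (measurableSet_lt measurable_const hYm.abs)

variable [IsProbabilityMeasure P]

/-- Under Lindeberg's condition this makes every individual variance in a row uniformly small. -/
lemma integral_sq_le_add_truncated {Y : Ω → ℝ} (hYm : Measurable Y) (hY : MemLp Y 2 P) {ε : ℝ}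
    (hε : 0 ≤ ε) :
    ∫ ω, Y ω ^ 2 ∂P ≤
      ε ^ 2 + ∫ ω, {ω' | ε < |Y ω'|}.indicator (fun ω' ↦ Y ω' ^ 2) ω ∂P := by
  calc ∫ ω, Y ω ^ 2 ∂P
      ≤ ∫ ω, (ε ^ 2 + {ω' | ε < |Y ω'|}.indicator (fun ω' ↦ Y ω' ^ 2) ω) ∂P := by
        refine integral_mono hY.integrable_sq
          ((integrable_const _).add (integrable_indicator_sq hYm hY ε)) fun ω ↦ ?_
        by_cases h : ε < |Y ω|
        · simp only [Set.indicator_of_mem (show ω ∈ {ω' | ε < |Y ω'|} from h)]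
          nlinarith [sq_nonneg ε]
        · simp only [Set.indicator_of_notMem (show ω ∉ {ω' | ε < |Y ω'|} from h)]
          push Not at h
          rw [← sq_abs (Y ω)]
          nlinarith [abs_nonneg (Y ω)]
    _ = _ := by
        rw [integral_add (integrable_const _) (integrable_indicator_sq hYm hY ε)]
        simp

/-- The characteristic function of a centred square-integrable variable at `1`, compared with that
of the centred Gaussian of the same variance. -/
lemma norm_integral_exp_sub_exp_le {Y : Ω → ℝ} (hYm : Measurable Y) (hY : MemLp Y 2 P)
    (hY0 : ∫ ω, Y ω ∂P = 0) {ε : ℝ} (hε0 : 0 < ε) (hε1 : ε ≤ 1) :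
    ‖∫ ω, Complex.exp (Y ω * Complex.I) ∂P -
        Complex.exp ((-((∫ ω, Y ω ^ 2 ∂P) / 2) : ℝ) : ℂ)‖ ≤
      ε * ∫ ω, Y ω ^ 2 ∂P +
      4 * ∫ ω, {ω' | ε < |Y ω'|}.indicator (fun ω' ↦ Y ω' ^ 2) ω ∂P +
      (∫ ω, Y ω ^ 2 ∂P) ^ 2 := by
  set v := ∫ ω, Y ω ^ 2 ∂P with hv
  have hv0 : 0 ≤ v := integral_nonneg fun ω ↦ sq_nonneg _
  have hi1 : Integrable (fun ω ↦ Complex.exp (Y ω * Complex.I)) P := by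
    refine (integrable_const (1 : ℝ)).mono (by fun_prop) (.of_forall fun ω ↦ ?_)
    simp [Complex.norm_exp_ofReal_mul_I]
  have hiY : Integrable (fun ω ↦ (Y ω : ℂ)) P := (hY.integrable (by norm_num)).ofReal
  have hiY2 : Integrable (fun ω ↦ (Y ω : ℂ) ^ 2) P := by
    simpa using hY.integrable_sq.ofReal (𝕜 := ℂ)
  have hi3 : Integrable (fun ω ↦ (1 + Y ω * Complex.I : ℂ)) P :=
    (integrable_const _).add (hiY.mul_const _)
  have hi2 : Integrable (fun ω ↦ (1 + Y ω * Complex.I - (Y ω : ℂ) ^ 2 / 2)) P :=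
    hi3.sub (hiY2.div_const _)
  have hint : ∫ ω, (1 + Y ω * Complex.I - (Y ω : ℂ) ^ 2 / 2) ∂P = ((1 - v / 2 : ℝ) : ℂ) := by
    rw [integral_sub hi3 (hiY2.div_const _),
      integral_add (integrable_const _) (hiY.mul_const _), integral_mul_const, integral_div,
      integral_complex_ofReal, hY0]
    have : ∫ ω, (Y ω : ℂ) ^ 2 ∂P = (v : ℂ) := by
      rw [hv, ← integral_complex_ofReal]
      simp
    rw [this]
    simp
  have h1 : ‖∫ ω, Complex.exp (Y ω * Complex.I) ∂P - ((1 - v / 2 : ℝ) : ℂ)‖ ≤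
      ε * v + 4 * ∫ ω, {ω' | ε < |Y ω'|}.indicator (fun ω' ↦ Y ω' ^ 2) ω ∂P := by
    rw [← hint, ← integral_sub hi1 hi2, hv, ← integral_const_mul, ← integral_const_mul,
      ← integral_add (hY.integrable_sq.const_mul _)
        ((integrable_indicator_sq hYm hY ε).const_mul _)]
    refine norm_integral_le_of_norm_le ((hY.integrable_sq.const_mul _).add
        ((integrable_indicator_sq hYm hY ε).const_mul _)) (.of_forall fun ω ↦ ?_)
    exact norm_exp_mul_I_sub_taylor_two_le hε0 hε1 (Y ω)
  have h2 : ‖((1 - v / 2 : ℝ) : ℂ) - Complex.exp ((-(v / 2) : ℝ) : ℂ)‖ ≤ v ^ 2 := by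
    rw [← Complex.ofReal_exp, ← Complex.ofReal_sub, Complex.norm_real, Real.norm_eq_abs,
      abs_sub_comm]
    refine (abs_exp_neg_sub_one_sub_le (by positivity)).trans ?_
    nlinarith [sq_nonneg v]
  calc _ ≤ _ := norm_sub_le_norm_sub_add_norm_sub _ ((1 - v / 2 : ℝ) : ℂ) _
    _ ≤ _ := add_le_add h1 h2

variable {E : Type*} [NormedAddCommGroup E] [InnerProductSpace ℝ E] [MeasurableSpace E]
  [BorelSpace E] [SecondCountableTopology E] [CompleteSpace E]

/-- A quantitative form of Lindeberg's theorem for characteristic functions. -/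
lemma norm_charFun_map_sum_sub_exp_le {ι : Type*} [Fintype ι] {X : ι → Ω → E}
    (hXm : ∀ r, Measurable (X r)) (hXi : iIndepFun X P) (hX : ∀ r, MemLp (X r) 2 P)
    (hX0 : ∀ r, ∫ ω, X r ω ∂P = 0) (t : E) {ε : ℝ} (hε0 : 0 < ε) (hε1 : ε ≤ 1) :
    ‖charFun (P.map (fun ω ↦ ∑ r, X r ω)) t -
        Complex.exp ((-((∑ r, ∫ ω, ⟪X r ω, t⟫ ^ 2 ∂P) / 2) : ℝ) : ℂ)‖ ≤
      ε * (∑ r, ∫ ω, ⟪X r ω, t⟫ ^ 2 ∂P) +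
      4 * (∑ r, ∫ ω, {ω' | ε < |⟪X r ω', t⟫|}.indicator (fun ω' ↦ ⟪X r ω', t⟫ ^ 2) ω ∂P) +
      (ε ^ 2 +
        ∑ r, ∫ ω, {ω' | ε < |⟪X r ω', t⟫|}.indicator (fun ω' ↦ ⟪X r ω', t⟫ ^ 2) ω ∂P) *
        (∑ r, ∫ ω, ⟪X r ω, t⟫ ^ 2 ∂P) := by
  set v : ι → ℝ := fun r ↦ ∫ ω, ⟪X r ω, t⟫ ^ 2 ∂P with hv
  set l : ι → ℝ := fun r ↦
    ∫ ω, {ω' | ε < |⟪X r ω', t⟫|}.indicator (fun ω' ↦ ⟪X r ω', t⟫ ^ 2) ω ∂P with hl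
  have hYm : ∀ r, Measurable fun ω ↦ ⟪X r ω, t⟫ := fun r ↦ (hXm r).inner_const
  have hY : ∀ r, MemLp (fun ω ↦ ⟪X r ω, t⟫) 2 P := fun r ↦ (hX r).inner_const t
  have hY0 : ∀ r, ∫ ω, ⟪X r ω, t⟫ ∂P = 0 := fun r ↦ by
    simp_rw [real_inner_comm t]
    rw [integral_inner ((hX r).integrable (by norm_num)), hX0 r, inner_zero_right]
  have hv0 : ∀ r, 0 ≤ v r := fun r ↦ integral_nonneg fun ω ↦ sq_nonneg _
  have hl0 : ∀ r, 0 ≤ l r := fun r ↦ integral_nonneg fun ω ↦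
    Set.indicator_nonneg (fun _ _ ↦ sq_nonneg _) _
  -- A bound independent of `r`, so that the quadratic errors satisfy `∑ v r ^ 2 ≤ (ε ^ 2 + ∑ l r) *
  -- ∑ v r`.
  have hvle : ∀ r, v r ≤ ε ^ 2 + ∑ r, l r := fun r ↦
    (integral_sq_le_add_truncated (hYm r) (hY r) hε0.le).trans <| by
      gcongr
      exact Finset.single_le_sum (fun r _ ↦ hl0 r) (Finset.mem_univ r)
  have hchar : ∀ r, charFun (P.map (X r)) t = ∫ ω, Complex.exp (⟪X r ω, t⟫ * Complex.I) ∂P :=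
    fun r ↦ by
      rw [charFun_apply, integral_map (hXm r).aemeasurable
        (Measurable.aestronglyMeasurable (by fun_prop))]
  have hexp : Complex.exp ((-((∑ r, v r) / 2) : ℝ) : ℂ) =
      ∏ r, Complex.exp ((-(v r / 2) : ℝ) : ℂ) := by
    rw [← Complex.exp_sum, ← Complex.ofReal_sum, Finset.sum_neg_distrib, Finset.sum_div]
  rw [hXi.charFun_map_fun_sum_eq_prod (fun r ↦ (hXm r).aemeasurable), Finset.prod_apply, hexp]
  refine (norm_prod_sub_prod_le_sum _ (fun r _ ↦ ?_) (fun r _ ↦ ?_)).trans ?_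
  · have := Measure.isProbabilityMeasure_map (μ := P) (hXm r).aemeasurable
    exact norm_charFun_le_one t
  · rw [← Complex.ofReal_exp, Complex.norm_real, Real.norm_eq_abs, Real.abs_exp]
    exact Real.exp_le_one_iff.2 (by have := hv0 r; linarith)
  calc ∑ r, ‖charFun (P.map (X r)) t - Complex.exp ((-(v r / 2) : ℝ) : ℂ)‖
      ≤ ∑ r, (ε * v r + 4 * l r + (ε ^ 2 + ∑ r, l r) * v r) := by
        refine Finset.sum_le_sum fun r _ ↦ ?_
        rw [hchar r]
        refine (norm_integral_exp_sub_exp_le (hYm r) (hY r) (hY0 r) hε0 hε1).trans ?_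
        have := mul_le_mul_of_nonneg_right (hvle r) (hv0 r)
        simp only [hv, hl] at this ⊢
        nlinarith
    _ = _ := by
        rw [Finset.sum_add_distrib, Finset.sum_add_distrib, Finset.mul_sum, Finset.mul_sum,
          Finset.mul_sum]

end Lindeberg

/-! ### From coordinates to linear functionals -/

section EuclideanSpace

variable {Ω ι : Type*} [MeasurableSpace Ω] {P : Measure Ω} [Fintype ι]

/-- The largest coordinate satisfies `|⟪x, t⟫| ≤ c * |x i|`. If the inner product exceeds `ε`, this
coordinate exceeds `ε / c`, and its term alone dominates. -/
lemma indicator_inner_sq_le (t x : EuclideanSpace ℝ ι) {ε c : ℝ}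
    (hc : ∀ i, Fintype.card ι * |t i| ≤ c) (hc0 : 0 < c) :
    {y : EuclideanSpace ℝ ι | ε < |⟪y, t⟫|}.indicator (fun y ↦ ⟪y, t⟫ ^ 2) x ≤
      c ^ 2 * ∑ i, {y : EuclideanSpace ℝ ι | ε / c < |y i|}.indicator (fun y ↦ y i ^ 2) x := by
  have hnn : ∀ i, 0 ≤ {y : EuclideanSpace ℝ ι | ε / c < |y i|}.indicator (fun y ↦ y i ^ 2) x :=
    fun i ↦ Set.indicator_nonneg (fun _ _ ↦ sq_nonneg _) _
  by_cases h : ε < |⟪x, t⟫|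
  swap
  · rw [Set.indicator_of_notMem (by exact h)]
    exact mul_nonneg (sq_nonneg c) (Finset.sum_nonneg fun i _ ↦ hnn i)
  rw [Set.indicator_of_mem (by exact h)]
  cases isEmpty_or_nonempty ι with
  | inl _ => simp [PiLp.inner_apply]
  | inr _ =>
    obtain ⟨i, hi⟩ := Finite.exists_max fun i ↦ |x i|
    have hle : |⟪x, t⟫| ≤ c * |x i| := by
      have hn : (0 : ℝ) < Fintype.card ι := by exact_mod_cast Fintype.card_pos
      calc |⟪x, t⟫| ≤ ∑ j, |t j| * |x j| := by
            simp only [PiLp.inner_apply, RCLike.inner_apply, conj_trivial]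
            exact (Finset.abs_sum_le_sum_abs _ _).trans_eq (by simp [abs_mul])
        _ ≤ ∑ _j : ι, (c / Fintype.card ι) * |x i| := by
            refine Finset.sum_le_sum fun j _ ↦ mul_le_mul ?_ (hi j) (abs_nonneg _) (by positivity)
            rw [le_div_iff₀' hn]
            exact hc j
        _ = c * |x i| := by
            rw [Finset.sum_const, Finset.card_univ, nsmul_eq_mul]
            field_simp
    have hmem : ε / c < |x i| := (div_lt_iff₀' hc0).2 (h.trans_le hle)
    calc ⟪x, t⟫ ^ 2 = |⟪x, t⟫| ^ 2 := (sq_abs _).symm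
      _ ≤ (c * |x i|) ^ 2 := by gcongr
      _ = c ^ 2 * {y : EuclideanSpace ℝ ι | ε / c < |y i|}.indicator (fun y ↦ y i ^ 2) x := by
          rw [Set.indicator_of_mem (by exact hmem), mul_pow, sq_abs]
      _ ≤ _ := by
          gcongr
          exact Finset.single_le_sum (fun i _ ↦ hnn i) (Finset.mem_univ i)

lemma sum_integral_indicator_inner_sq_le {κ : Type*} [Fintype κ]
    {X : κ → Ω → EuclideanSpace ℝ ι}
    (hXm : ∀ r, Measurable (X r)) (hX : ∀ r, MemLp (X r) 2 P)
    (t : EuclideanSpace ℝ ι) {ε c : ℝ}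
    (hc : ∀ i, Fintype.card ι * |t i| ≤ c) (hc0 : 0 < c) :
    ∑ r, ∫ ω, {ω' | ε < |⟪X r ω', t⟫|}.indicator (fun ω' ↦ ⟪X r ω', t⟫ ^ 2) ω ∂P ≤
      c ^ 2 * ∑ i, ∑ r,
        ∫ ω, {ω' | ε / c < |X r ω' i|}.indicator (fun ω' ↦ (X r ω' i) ^ 2) ω ∂P := by
  have hcoord : ∀ r i, Integrable (fun ω ↦
      {ω' | ε / c < |X r ω' i|}.indicator (fun ω' ↦ (X r ω' i) ^ 2) ω) P := fun r i ↦
    integrable_indicator_sq (by have := hXm r; fun_prop)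
      ((EuclideanSpace.proj (𝕜 := ℝ) i).comp_memLp' (hX r)) _
  rw [Finset.sum_comm, Finset.mul_sum]
  refine Finset.sum_le_sum fun r _ ↦ ?_
  rw [← integral_finsetSum _ fun i _ ↦ hcoord r i, ← integral_const_mul]
  refine integral_mono
    (integrable_indicator_sq (hXm r).inner_const ((hX r).inner_const t) ε)
    ((integrable_finsetSum _ fun i _ ↦ hcoord r i).const_mul _) fun ω ↦ ?_
  exact indicator_inner_sq_le t (X r ω) hc hc0

variable [IsProbabilityMeasure P]

lemma variance_inner_eq_dotProduct {S : Ω → EuclideanSpace ℝ ι} (hSm : Measurable S)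
    (hS : MemLp S 2 P) (t : EuclideanSpace ℝ ι) :
    Var[fun ω ↦ ⟪S ω, t⟫; P] =
      t ⬝ᵥ (Matrix.of fun i j ↦ cov[fun ω ↦ S ω i, fun ω ↦ S ω j; P]) *ᵥ t := by
  have hc : ∀ i, MemLp (fun ω ↦ S ω i) 2 P := fun i ↦
    (EuclideanSpace.proj (𝕜 := ℝ) i).comp_memLp' hS
  rw [← covariance_self (by fun_prop)]
  simp only [PiLp.inner_apply, RCLike.inner_apply, conj_trivial]
  rw [covariance_fun_sum_fun_sum (fun i ↦ (hc i).const_mul _) (fun i ↦ (hc i).const_mul _)]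
  simp only [dotProduct, Matrix.mulVec, Matrix.of_apply, Finset.mul_sum]
  refine Finset.sum_congr rfl fun i _ ↦ Finset.sum_congr rfl fun j _ ↦ ?_
  rw [covariance_const_mul_left, covariance_const_mul_right]
  ring

lemma posSemidef_covariance {S : Ω → EuclideanSpace ℝ ι} (hSm : Measurable S) (hS : MemLp S 2 P) :
    (Matrix.of fun i j ↦ cov[fun ω ↦ S ω i, fun ω ↦ S ω j; P]).PosSemidef := by
  refine .of_dotProduct_mulVec_nonneg ?_ fun x ↦ ?_
  · ext i j
    simp [covariance_comm]
  · have := variance_inner_eq_dotProduct hSm hS (WithLp.toLp 2 x)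
    simp only [star_trivial]
    exact this ▸ variance_nonneg _ _

lemma sum_integral_inner_sq_eq_dotProduct {κ : Type*} [Fintype κ]
    {X : κ → Ω → EuclideanSpace ℝ ι}
    (hXm : ∀ r, Measurable (X r)) (hXi : iIndepFun X P) (hX : ∀ r, MemLp (X r) 2 P)
    (hX0 : ∀ r, ∫ ω, X r ω ∂P = 0) (t : EuclideanSpace ℝ ι) :
    ∑ r, ∫ ω, ⟪X r ω, t⟫ ^ 2 ∂P =
      t ⬝ᵥ (Matrix.of fun i j ↦ cov[fun ω ↦ (∑ r, X r ω) i, fun ω ↦ (∑ r, X r ω) j; P]) *ᵥ t := by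
  have hY : ∀ r, MemLp (fun ω ↦ ⟪X r ω, t⟫) 2 P := fun r ↦ (hX r).inner_const t
  have hY0 : ∀ r, ∫ ω, ⟪X r ω, t⟫ ∂P = 0 := fun r ↦ by
    simp_rw [real_inner_comm t]
    rw [integral_inner ((hX r).integrable (by norm_num)), hX0 r, inner_zero_right]
  have hmem : MemLp (fun ω ↦ ∑ r, X r ω) 2 P := memLp_finsetSum _ fun r _ ↦ hX r
  have hmeas : Measurable (fun ω ↦ ∑ r, X r ω) := Finset.measurable_sum _ fun r _ ↦ hXm r
  rw [← variance_inner_eq_dotProduct hmeas hmem]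
  have hs : (fun ω ↦ ⟪∑ r, X r ω, t⟫) = ∑ r, fun ω ↦ ⟪X r ω, t⟫ := by
    ext ω
    simp [sum_inner]
  rw [hs, IndepFun.variance_sum (fun r _ ↦ hY r) fun r _ s _ hrs ↦
    (hXi.indepFun hrs).comp (φ := fun x ↦ ⟪x, t⟫) (ψ := fun x ↦ ⟪x, t⟫)
      (by fun_prop) (by fun_prop)]
  exact Finset.sum_congr rfl fun r _ ↦
    (variance_of_integral_eq_zero ((hXm r).inner_const).aemeasurable (hY0 r)).symm

end EuclideanSpace

/-! ### Entry bounds and limits of positive semidefinite matrices -/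

section PosSemidef

/-- Evaluate the quadratic form at `e_i + e_j` and `e_i - e_j`. Bounds on the diagonal thus control
every entry. -/
lemma Matrix.PosSemidef.abs_apply_le {n : Type*} [Fintype n] {M : Matrix n n ℝ}
    (hM : M.PosSemidef) (i j : n) : |M i j| ≤ (M i i + M j j) / 2 := by
  classical
  have hs : M j i = M i j := by simpa using hM.isHermitian.apply i j
  have h1 := hM.dotProduct_mulVec_nonneg (Pi.single i 1 + Pi.single j 1)
  have h2 := hM.dotProduct_mulVec_nonneg (Pi.single i 1 - Pi.single j 1)
  simp [Matrix.mulVec_add, Matrix.mulVec_sub, add_dotProduct, sub_dotProduct, dotProduct_add,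
    dotProduct_sub, hs] at h1 h2
  rw [abs_le]
  constructor <;> linarith

lemma tendsto_dotProduct_mulVec {n : Type*} [Fintype n] {M : ℕ → Matrix n n ℝ}
    {N : Matrix n n ℝ} (h : ∀ i j, Tendsto (fun k ↦ M k i j) atTop (𝓝 (N i j))) (x : n → ℝ) :
    Tendsto (fun k ↦ x ⬝ᵥ M k *ᵥ x) atTop (𝓝 (x ⬝ᵥ N *ᵥ x)) := by
  simp only [dotProduct, Matrix.mulVec]
  exact tendsto_finsetSum _ fun i _ ↦ (tendsto_finsetSum _ fun j _ ↦
      (h i j).mul_const _).const_mul _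

lemma Matrix.PosSemidef.of_tendsto {n : Type*} [Fintype n] {M : ℕ → Matrix n n ℝ}
    {N : Matrix n n ℝ} (hM : ∀ k, (M k).PosSemidef)
    (h : ∀ i j, Tendsto (fun k ↦ M k i j) atTop (𝓝 (N i j))) : N.PosSemidef := by
  refine .of_dotProduct_mulVec_nonneg ?_ fun x ↦ ?_
  · ext i j
    refine tendsto_nhds_unique (h j i) ((h i j).congr fun k ↦ ?_)
    simpa using (hM k).isHermitian.apply j i
  · exact ge_of_tendsto' (tendsto_dotProduct_mulVec h x) fun k ↦
      (hM k).dotProduct_mulVec_nonneg x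

end PosSemidef

/-! ### Lévy continuity and the Lindeberg theorem -/

section WeakConvergence

variable {d : Type*} [Fintype d] [DecidableEq d]

lemma tendsto_integral_of_tendsto_charFun {E : Type*} [NormedAddCommGroup E]
    [InnerProductSpace ℝ E] [FiniteDimensional ℝ E] [MeasurableSpace E] [BorelSpace E]
    {μ : ℕ → Measure E} [∀ n, IsProbabilityMeasure (μ n)] {ν : Measure E}
    [IsProbabilityMeasure ν]
    (h : ∀ t, Tendsto (fun n ↦ charFun (μ n) t) atTop (𝓝 (charFun ν t))) (f : E →ᵇ ℝ) :
    Tendsto (fun n ↦ ∫ x, f x ∂(μ n)) atTop (𝓝 (∫ x, f x ∂ν)) :=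
  ProbabilityMeasure.tendsto_iff_forall_integral_tendsto.1
    (ProbabilityMeasure.tendsto_of_tendsto_charFun
      (μ := fun n ↦ ⟨μ n, inferInstance⟩) (μ₀ := ⟨ν, inferInstance⟩) h) f

lemma charFun_multivariateGaussian_zero {S : Matrix d d ℝ} (hS : S.PosSemidef)
    (t : EuclideanSpace ℝ d) :
    charFun (multivariateGaussian 0 S) t = Complex.exp ((-((t ⬝ᵥ S *ᵥ t) / 2) : ℝ) : ℂ) := by
  rw [charFun_multivariateGaussian hS]
  simp

lemma tendsto_integral_multivariateGaussian {M : ℕ → Matrix d d ℝ} {N : Matrix d d ℝ}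
    (hM : ∀ k, (M k).PosSemidef) (h : ∀ i j, Tendsto (fun k ↦ M k i j) atTop (𝓝 (N i j)))
    (f : EuclideanSpace ℝ d →ᵇ ℝ) :
    Tendsto (fun k ↦ ∫ x, f x ∂(multivariateGaussian 0 (M k))) atTop
      (𝓝 (∫ x, f x ∂(multivariateGaussian 0 N))) := by
  refine tendsto_integral_of_tendsto_charFun (fun t ↦ ?_) f
  simp_rw [charFun_multivariateGaussian_zero (Matrix.PosSemidef.of_tendsto hM h),
    fun k ↦ charFun_multivariateGaussian_zero (hM k)]
  have := tendsto_dotProduct_mulVec h t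
  exact (Complex.continuous_exp.tendsto _).comp
    ((Complex.continuous_ofReal.tendsto _).comp (this.div_const 2).neg)

/-- The **Lindeberg central limit theorem** for triangular arrays of random vectors. -/
theorem tendsto_integral_map_sum_of_lindeberg {Ω κ : ℕ → Type*} [∀ n, MeasurableSpace (Ω n)]
    [∀ n, Fintype (κ n)] (P : ∀ n, Measure (Ω n)) [∀ n, IsProbabilityMeasure (P n)]
    {X : ∀ n, κ n → Ω n → EuclideanSpace ℝ d}
    (hXm : ∀ n r, Measurable (X n r)) (hXi : ∀ n, iIndepFun (X n) (P n))
    (hX : ∀ n r, MemLp (X n r) 2 (P n)) (hX0 : ∀ n r, ∫ ω, X n r ω ∂(P n) = 0)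
    {N : Matrix d d ℝ}
    (hcov : ∀ i j, Tendsto
      (fun n ↦ cov[fun ω ↦ (∑ r, X n r ω) i, fun ω ↦ (∑ r, X n r ω) j; P n]) atTop (𝓝 (N i j)))
    (hlin : ∀ ε : ℝ, 0 < ε → ∀ i, Tendsto
      (fun n ↦ ∑ r, ∫ ω, {ω' | ε < |X n r ω' i|}.indicator
        (fun ω' ↦ (X n r ω' i) ^ 2) ω ∂(P n)) atTop (𝓝 0))
    (f : EuclideanSpace ℝ d →ᵇ ℝ) :
    Tendsto (fun n ↦ ∫ x, f x ∂((P n).map (fun ω ↦ ∑ r, X n r ω))) atTop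
      (𝓝 (∫ x, f x ∂(multivariateGaussian 0 N))) := by
  have hSm : ∀ n, Measurable (fun ω ↦ ∑ r, X n r ω) := fun n ↦
    Finset.measurable_sum _ fun r _ ↦ hXm n r
  have hS2 : ∀ n, MemLp (fun ω ↦ ∑ r, X n r ω) 2 (P n) := fun n ↦
    memLp_finsetSum _ fun r _ ↦ hX n r
  have : ∀ n, IsProbabilityMeasure ((P n).map (fun ω ↦ ∑ r, X n r ω)) := fun n ↦
    Measure.isProbabilityMeasure_map (hSm n).aemeasurable
  have hN : N.PosSemidef :=
    Matrix.PosSemidef.of_tendsto (fun n ↦ posSemidef_covariance (hSm n) (hS2 n)) hcov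
  refine tendsto_integral_of_tendsto_charFun (fun t ↦ ?_) f
  rw [charFun_multivariateGaussian_zero hN]
  set V : ℕ → ℝ := fun n ↦ ∑ r, ∫ ω, ⟪X n r ω, t⟫ ^ 2 ∂(P n) with hVdef
  have hV : Tendsto V atTop (𝓝 (t ⬝ᵥ N *ᵥ t)) := by
    simp_rw [hVdef, fun n ↦ sum_integral_inner_sq_eq_dotProduct (hXm n) (hXi n) (hX n) (hX0 n) t]
    exact tendsto_dotProduct_mulVec hcov t
  have hL : ∀ ε : ℝ, 0 < ε → Tendsto (fun n ↦ ∑ r, ∫ ω,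
      {ω' | ε < |⟪X n r ω', t⟫|}.indicator (fun ω' ↦ ⟪X n r ω', t⟫ ^ 2) ω ∂(P n))
      atTop (𝓝 0) := by
    intro ε hε
    obtain ⟨c, hc0, hc⟩ : ∃ c : ℝ, 0 < c ∧ ∀ i, Fintype.card d * |t i| ≤ c := by
      -- The `+ 1` keeps `c` positive when `t = 0`.
      refine ⟨∑ i, Fintype.card d * |t i| + 1, by positivity, fun i ↦ ?_⟩
      have := Finset.single_le_sum (f := fun i ↦ Fintype.card d * |t i|)
        (fun i _ ↦ by positivity) (Finset.mem_univ i)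
      simp only at this
      linarith
    refine tendsto_of_tendsto_of_tendsto_of_le_of_le tendsto_const_nhds ?_
      (fun n ↦ Finset.sum_nonneg fun r _ ↦ integral_nonneg fun ω ↦
        Set.indicator_nonneg (fun _ _ ↦ sq_nonneg _) _)
      (fun n ↦ sum_integral_indicator_inner_sq_le (hXm n) (hX n) t hc hc0)
    simpa using (tendsto_finsetSum Finset.univ
      fun i _ ↦ hlin (ε / c) (div_pos hε hc0) i).const_mul (c ^ 2)
  have hexp : Tendsto (fun n ↦ Complex.exp ((-(V n / 2) : ℝ) : ℂ)) atTop
      (𝓝 (Complex.exp ((-((t ⬝ᵥ N *ᵥ t) / 2) : ℝ) : ℂ))) :=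
    (Complex.continuous_exp.tendsto _).comp
      ((Complex.continuous_ofReal.tendsto _).comp (hV.div_const 2).neg)
  suffices h : Tendsto (fun n ↦ charFun ((P n).map (fun ω ↦ ∑ r, X n r ω)) t -
      Complex.exp ((-(V n / 2) : ℝ) : ℂ)) atTop (𝓝 0) by
    simpa using h.add hexp
  set W := t ⬝ᵥ N *ᵥ t with hW
  have hW0 : 0 ≤ W := ge_of_tendsto' hV fun n ↦
    Finset.sum_nonneg fun r _ ↦ integral_nonneg fun ω ↦ sq_nonneg _
  rw [Metric.tendsto_atTop']
  intro δ hδ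
  -- For fixed `ε` the Lindeberg bound tends to `ε * W + ε ^ 2 * W`, at most `2 * ε * W` since `ε ≤
  -- 1`. The `+ 1` in the witness covers the degenerate case `W = 0`.
  obtain ⟨ε, hε0, hε1, hεδ⟩ : ∃ ε : ℝ, 0 < ε ∧ ε ≤ 1 ∧ 2 * ε * W < δ := by
    refine ⟨min 1 (δ / (2 * W + 1) / 2), by positivity, min_le_left _ _, ?_⟩
    have h1 : 2 * min 1 (δ / (2 * W + 1) / 2) * W ≤ 2 * (δ / (2 * W + 1) / 2) * W := by
      gcongr
      exact min_le_right _ _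
    refine h1.trans_lt ?_
    have : 2 * (δ / (2 * W + 1) / 2) * W = δ * (W / (2 * W + 1)) := by ring
    rw [this]
    have h2 : W / (2 * W + 1) < 1 := by
      rw [div_lt_one (by positivity)]
      linarith
    nlinarith
  have hbound := ((hV.const_mul ε).add ((hL ε hε0).const_mul 4)).add
    (((hL ε hε0).const_add (ε ^ 2)).mul hV)
  have hlt : ε * W + 4 * 0 + (ε ^ 2 + 0) * W < δ := by
    have : ε ^ 2 * W ≤ ε * W := by
      gcongr
      nlinarith
    linarith
  obtain ⟨n₀, hn₀⟩ := eventually_atTop.1 (hbound.eventually_lt_const hlt)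
  refine ⟨n₀, fun n hn ↦ ?_⟩
  rw [dist_zero_right]
  exact (norm_charFun_map_sum_sub_exp_le (hXm n) (hXi n) (hX n) (hX0 n) t hε0 hε1).trans_lt
    (hn₀ n hn.le)

end WeakConvergence

/-! ### Uniform theorem by compactness -/

theorem theorem3 {d : ℕ} (k : ℕ → ℕ) (hk : Tendsto k atTop atTop)
    {Ω : ℕ → ℕ → Type*} [∀ n p, MeasurableSpace (Ω n p)]
    (P : ∀ n p, Measure (Ω n p)) [∀ n p, IsProbabilityMeasure (P n p)]
    (X : ∀ n p, Fin (k n) → Ω n p → EuclideanSpace ℝ (Fin d))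
    (hX_meas : ∀ n p r, Measurable (X n p r))
    (hX_indep : ∀ n p, iIndepFun (X n p) (P n p))
    (hX_sq : ∀ n p r, MemLp (X n p r) 2 (P n p))
    (hX_mean : ∀ n p r, ∫ ω, X n p r ω ∂(P n p) = 0)
    (S : ∀ n p, Ω n p → EuclideanSpace ℝ (Fin d))
    (hS : ∀ n p ω, S n p ω = ∑ r, X n p r ω)
    (Sig : ℕ → Matrix (Fin d) (Fin d) ℝ)
    (h_cov : ∀ i j, TendstoUniformOver
      (fun n p ↦ cov[fun ω ↦ S n p ω i, fun ω ↦ S n p ω j; P n p]) (fun p ↦ Sig p i j))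
    (h_diag : ∀ i, BddAbove (Set.range fun p ↦ Sig p i i))
    (h_lindeberg : ∀ ε : ℝ, 0 < ε → ∀ i, TendstoUniformOver
      (fun n p ↦ ∑ r, ∫ ω, {ω' | ε < |X n p r ω' i|}.indicator
        (fun ω' ↦ (X n p r ω' i) ^ 2) ω ∂(P n p))
      (fun _ ↦ 0)) :
    (∀ p, (Sig p).PosSemidef) ∧
      WeakConvUniformOver (fun n p ↦ (P n p).map (S n p))
        (fun p ↦ multivariateGaussian 0 (Sig p)) := by
  obtain rfl : S = fun n p ω ↦ ∑ r, X n p r ω := by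
    ext1 n; ext1 p; ext1 ω; exact hS n p ω
  have hSm : ∀ n p, Measurable (fun ω ↦ ∑ r, X n p r ω) := fun n p ↦
    Finset.measurable_sum _ fun r _ ↦ hX_meas n p r
  have hS2 : ∀ n p, MemLp (fun ω ↦ ∑ r, X n p r ω) 2 (P n p) := fun n p ↦
    memLp_finsetSum _ fun r _ ↦ hX_sq n p r
  -- For fixed `p`, condition (a) makes `Sig p` an entrywise limit of covariance matrices.
  have hpsd : ∀ p, (Sig p).PosSemidef := fun p ↦
    Matrix.PosSemidef.of_tendsto (fun n ↦ posSemidef_covariance (hSm n p) (hS2 n p)) fun i j ↦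
      tendsto_sub_nhds_zero_iff.1 ((h_cov i j).tendsto_sub tendsto_id fun _ ↦ p)
  refine ⟨hpsd, fun f ↦ tendstoUniformOver_of_forall_seq fun q ↦
    tendsto_of_subseq_tendsto fun ns hns ↦ ?_⟩
  choose B hB using fun i ↦ h_diag i
  have hB' : ∀ i p, Sig p i i ≤ B i := fun i p ↦ hB i ⟨p, rfl⟩
  -- The entries of `Sig (q (ns n))` lie in a fixed product of compact intervals, which yields a
  -- convergent subsequence.
  obtain ⟨N, -, ms, hms, hN⟩ := (isCompact_univ_pi fun i ↦ isCompact_univ_pi fun j ↦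
      isCompact_Icc (a := -((B i + B j) / 2)) (b := (B i + B j) / 2)).tendsto_subseq
    (x := fun n i j ↦ Sig (q (ns n)) i j) fun n i _ j _ ↦ by
      refine abs_le.1 (((hpsd (q (ns n))).abs_apply_le i j).trans ?_)
      have := hB' i (q (ns n))
      have := hB' j (q (ns n))
      linarith
  have hN' : ∀ i j, Tendsto (fun n ↦ Sig (q (ns (ms n))) i j) atTop (𝓝 (Matrix.of N i j)) :=
    fun i j ↦ tendsto_pi_nhds.1 (tendsto_pi_nhds.1 hN i) j
  have hu : Tendsto (fun n ↦ ns (ms n)) atTop atTop := hns.comp hms.tendsto_atTop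
  refine ⟨ms, ?_⟩
  have hsum := tendsto_integral_map_sum_of_lindeberg (N := Matrix.of N)
    (fun n ↦ P (ns (ms n)) (q (ns (ms n))))
    (fun n r ↦ hX_meas (ns (ms n)) (q (ns (ms n))) r) (fun n ↦ hX_indep _ _)
    (fun n r ↦ hX_sq _ _ r) (fun n r ↦ hX_mean _ _ r)
    -- The covariance minus the entry of `Sig` tends to zero by (a), and that entry tends to the one
    -- of `N`.
    (fun i j ↦ by
      simpa using ((h_cov i j).tendsto_sub hu fun n ↦ q (ns (ms n))).add (hN' i j))
    (fun ε hε i ↦ by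
      simpa using (h_lindeberg ε hε i).tendsto_sub hu fun n ↦ q (ns (ms n))) f
  simpa using hsum.sub
    (tendsto_integral_multivariateGaussian (fun n ↦ hpsd (q (ns (ms n)))) hN' f)
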